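/- Let $d\ge 1$, let $\mathcal X,\mathcal G\in\mathbb C^{n_1\times\cdots\times n_d}$, and let $A^{(j)}\in\mathbb C^{n_j\times n_j}$ ($1\le j\le d$) be normal matrices such that $$\mathcal X\times_1 A^{(1)}+\cdots+\mathcal X\times_d A^{(d)}=\mathcal G,$$ where $(\mathcal X\times_k A)_{i_1,\ldots,i_{k-1},j,i_{k+1},\ldots,i_d}=\sum_{i_k=1}^{n_k}\mathcal X_{i_1,\ldots,i_d}A_{j,i_k}$ is the $k$-mode product. Suppose that the $A^{(j)}$ are Minkowski singly separated with sets $E_j,F_j\subseteq\mathbb C$, that is, for every $1\le j\le d$ the sets $E_j$ and $F_j$ are disjoint, $$\Lambda(A^{(j)})\subseteq E_j\qquad\text{and}\qquad -\sum_{k\ne j}\Lambda(A^{(k)})\subseteq F_j,$$ where $\Lambda$ denotes the spectrum and the sum is a Minkowski sum (the empty sum being $\{0\}$). An orthogonal Tucker decomposition of size $t=(t_1,\ldots,t_d)$ of a tensor $\mathcal Y\in\mathbb C^{n_1\times\cdots\times n_d}$ consists of a core tensor $\mathcal C\in\mathbb C^{t_1\times\cdots\times t_d}$ and matrices $U^{(j)}\in\mathbb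 C^{n_j\times t_j}$ with orthonormal columns such that $\mathcal Y_{i_1,\ldots,i_d}=\sum_{a_1=1}^{t_1}\cdots\sum_{a_d=1}^{t_d}\mathcal C_{a_1,\ldots,a_d}\prod_{j=1}^d U^{(j)}_{i_j,a_j}$. The multilinear rank of a tensor is the tuple whose $j$th entry is the smallest $t_j$ that occurs in an orthogonal Tucker decomposition of it. For $0<\epsilon<1$, let $p^{\mathrm{ML}}_\epsilon(\mathcal X)$ be the smallest value of $\sum_{j=1}^d n_jt_j+\prod_{j=1}^d t_j$ over all $t$ for which some tensor $\mathcal Y$ with $\|\mathcal X-\mathcal Y\|_F\le\epsilon\|\mathcal X\|_F$ has an orthogonal Tucker decomposition of size $t$; here $\|\cdot\|_F$ is the Frobenius norm. For an integer $k\ge0$ and $E,F\subseteq\mathbb C$, the Zolotarev number is $$Z_k(E,F)=\inf_{r}\frac{\sup_{z\in E}|r(z)|}{\inf_{z\in F}|r(z)|},$$ the infimum being over the rational functions $r=p/q$ in lowest terms with $\deg p,\deg q\le k$ (with $|r|=\infty$ at poles; functions with $\sup_E|r|=\infty$ or $\inf_F|r|=0$ are disregarded). Let $0<\epsilon<1$,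 let $(\mu_1,\ldots,\mu_d)$ be the multilinear rank of $\mathcal G$, and let $k_1,\ldots,k_d\ge0$ be integers with $Z_{k_j}(E_j,F_j)\le\epsilon/\sqrt d$ for $1\le j\le d$. Then there is a tensor $\tilde{\mathcal X}\in\mathbb C^{n_1\times\cdots\times n_d}$ with $$\|\mathcal X-\tilde{\mathcal X}\|_F\le\epsilon\|\mathcal X\|_F$$ that has an orthogonal Tucker decomposition of some size $(t_1,\ldots,t_d)$ with $t_j\le k_j\mu_j$ for all $j$. Consequently $$p^{\mathrm{ML}}_\epsilon(\mathcal X)\le\sum_{j=1}^d n_jk_j\mu_j+\prod_{j=1}^d k_j\mu_j .$$ -/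

import Mathlib

open scoped ENNReal Matrix Pointwise

noncomputable section

namespace TuckerDisplacement

/-- Complex tensors of order `d` and size `n 0 × ⋯ × n (d - 1)`. -/
abbrev Tensor {d : ℕ} (n : Fin d → ℕ) : Type := (∀ j, Fin (n j)) → ℂ

/-- The Frobenius norm of a tensor. -/
def frobeniusNorm {d : ℕ} {n : Fin d → ℕ} (X : Tensor n) : ℝ :=
  Real.sqrt (∑ i, ‖X i‖ ^ 2)

/-- The `k`-mode product `X ×ₖ A`: its entry at `i` is the sum over `l` of
`A (i k) l` times the entry of `X` whose `k`-th index `i k` is replaced by `l`. -/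
def modeProduct {d : ℕ} {n : Fin d → ℕ} (X : Tensor n) (k : Fin d)
    (A : Matrix (Fin (n k)) (Fin (n k)) ℂ) : Tensor n :=
  fun i => ∑ l : Fin (n k), X (Function.update i k l) * A (i k) l

/-- The double bracket `⟦C; U⁽¹⁾, …, U⁽ᵈ⁾⟧`: the sum over all multi-indices `a` of `C a` times the
outer product of the columns `a j` of the matrices `U j`. -/
def bracket {d : ℕ} {n t : Fin d → ℕ} (C : Tensor t)
    (U : ∀ j, Matrix (Fin (n j)) (Fin (t j)) ℂ) : Tensor n :=
  fun i => ∑ a, C a * ∏ j, U j (i j) (a j)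

/-- `X` has an orthogonal Tucker decomposition of size `t`: a core tensor of size `t`, and factor
matrices with orthonormal columns. -/
def HasOrthogonalTucker {d : ℕ} {n : Fin d → ℕ} (X : Tensor n) (t : Fin d → ℕ) : Prop :=
  ∃ (C : Tensor t) (U : ∀ j, Matrix (Fin (n j)) (Fin (t j)) ℂ),
    (∀ j, (U j)ᴴ * U j = 1) ∧ X = bracket C U

/-- The multilinear rank of `X`: its `j`-th entry is the smallest `j`-th size `t j` in an
orthogonal Tucker decomposition of `X`. -/
def multilinearRank {d : ℕ} {n : Fin d → ℕ} (X : Tensor n) : Fin d → ℕ :=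
  fun j => sInf {r | ∃ t : Fin d → ℕ, HasOrthogonalTucker X t ∧ t j = r}

/-- The number of degrees of freedom stored by a Tucker decomposition of size `t` of a tensor of
size `n`: the entries of the factor matrices and those of the core. -/
def tuckerStorage {d : ℕ} (n t : Fin d → ℕ) : ℕ :=
  ∑ j, n j * t j + ∏ j, t j

/-- `p^ML_ε(X)`: the least number of degrees of freedom of an orthogonal Tucker decomposition of
a tensor that approximates `X` to relative accuracy `ε` in the Frobenius norm. -/
def tuckerCompressibility {d : ℕ} {n : Fin d → ℕ} (ε : ℝ) (X : Tensor n) : ℕ :=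
  sInf {p | ∃ (Y : Tensor n) (t : Fin d → ℕ),
    frobeniusNorm (X - Y) ≤ ε * frobeniusNorm X ∧ HasOrthogonalTucker Y t ∧
      p = tuckerStorage n t}

/-- The modulus `|r z|` of a rational function at a complex number, equal to `∞` at a pole.
(The numerator and denominator `r.num`, `r.denom` are coprime, so `0 / 0` does not occur.) -/
def ratAbs (r : RatFunc ℂ) (z : ℂ) : ℝ≥0∞ :=
  ‖r.num.eval z‖ₑ / ‖r.denom.eval z‖ₑ

/-- The Zolotarev number `Z_k(E, F)`: the infimum of `sup_E |r| / inf_F |r|` over the rational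
functions `r` of type `(k, k)`. A function with `sup_E |r| = ∞` or `inf_F |r| = 0` does not
contribute: its quotient is `∞` or an indeterminate `∞ / ∞` or `0 / 0`. -/
def zolotarev (k : ℕ) (E F : Set ℂ) : ℝ≥0∞ :=
  ⨅ (r : RatFunc ℂ) (_ : r.num.natDegree ≤ k) (_ : r.denom.natDegree ≤ k)
    (_ : (⨆ z ∈ E, ratAbs r z) ≠ ∞) (_ : (⨅ z ∈ F, ratAbs r z) ≠ 0),
    (⨆ z ∈ E, ratAbs r z) / (⨅ z ∈ F, ratAbs r z)

/-- The normal matrices `A j` are Minkowski singly separated with the disjoint sets `E j`, `F j`.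
The sums of spectra are Minkowski sums (the empty one is `{0}`). -/
structure MinkowskiSinglySeparated {d : ℕ} {n : Fin d → ℕ}
    (A : ∀ j, Matrix (Fin (n j)) (Fin (n j)) ℂ) (E F : Fin d → Set ℂ) : Prop where
  normal : ∀ j, IsStarNormal (A j)
  disjoint : ∀ j, Disjoint (E j) (F j)
  spectrum_subset : ∀ j, spectrum ℂ (A j) ⊆ E j
  neg_sum_subset : ∀ j, -(∑ k ∈ Finset.univ.erase j, spectrum ℂ (A k)) ⊆ F j

end TuckerDisplacement

end

namespace TuckerDisplacement

/-! ### Multilinear algebra of the bracket -/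

variable {d : ℕ} {n m t : Fin d → ℕ}

/-! Unitary diagonalization in every mode preserves Frobenius norms and Tucker sizes and turns the
equation into `(x - y) * X' = G'` entrywise. For a fixed mode `j`, `x ∈ E j` is an eigenvalue of `A
j`, and `y ∈ F j` is minus a sum of eigenvalues of the other modes, so it does not depend on `i j`.

For `r = p/q` put `Y = (1 - r(x)/r(y)) X'`. The error is at most `sup_E |r| / inf_F |r|` times `X'`,
entry by entry. Bezout's kernel writes `p(x)q(y) - q(x)p(y)` as `(x - y) ∑ x^s c_s(y)` with `k`
terms. The factor `x - y` turns `X'` into `G'`, so the mode-`j` fibres of `Y` lie in a space of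
dimension at most `k * μ` (`exists_low_rank_approximation`).

A best mode-`j` projection is at least as good as every such `Y`, hence has relative error at most
`Z_k` (`exists_mode_projection_of_zolotarev_le`). Applying the projections in all modes adds squared
errors: `d * (ε/√d)^2 = ε^2` (`exists_tucker_of_mode_projections`). -/

theorem bracket_bracket (C : Tensor t) (V : ∀ j, Matrix (Fin (m j)) (Fin (t j)) ℂ)
    (U : ∀ j, Matrix (Fin (n j)) (Fin (m j)) ℂ) :
    bracket (bracket C V) U = bracket C (fun j => U j * V j) := by
  funext i
  simp only [bracket, Finset.sum_mul]
  rw [Finset.sum_comm]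
  refine Finset.sum_congr rfl fun b _ => ?_
  simp only [Matrix.mul_apply]
  rw [Finset.prod_univ_sum, Fintype.piFinset_univ, Finset.mul_sum]
  refine Finset.sum_congr rfl fun a _ => ?_
  rw [mul_assoc, ← Finset.prod_mul_distrib]
  congr 1
  exact Finset.prod_congr rfl fun j _ => mul_comm _ _

/-- The family of square matrices that is `A` in mode `j` and the identity in all other modes. -/
noncomputable def modeFactor (j : Fin d) (A : Matrix (Fin (n j)) (Fin (n j)) ℂ) (k : Fin d) :
    Matrix (Fin (n k)) (Fin (n k)) ℂ :=
  Function.update (β := fun k => Matrix (Fin (n k)) (Fin (n k)) ℂ) (fun _ => 1) j A k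

theorem modeFactor_self (j : Fin d) (A : Matrix (Fin (n j)) (Fin (n j)) ℂ) :
    modeFactor j A j = A := by
  simp [modeFactor]

theorem modeFactor_of_ne {j k : Fin d} (h : k ≠ j) (A : Matrix (Fin (n j)) (Fin (n j)) ℂ) :
    modeFactor j A k = 1 := by
  simp [modeFactor, h]

theorem bracket_modeFactor (X : Tensor n) (j : Fin d) (A : Matrix (Fin (n j)) (Fin (n j)) ℂ) :
    bracket X (modeFactor j A) = modeProduct X j A := by
  funext i
  simp only [bracket, modeProduct]
  symm
  refine Finset.sum_of_injOn (fun l => Function.update i j l)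
    ((Function.update_injective i j).injOn) (by simp) ?_ ?_
  · intro a _ ha
    obtain ⟨k, hkj, hk⟩ : ∃ k, k ≠ j ∧ i k ≠ a k := by
      by_contra! h
      refine ha ⟨a j, by simp, ?_⟩
      funext k
      by_cases hk : k = j
      · subst hk; simp
      · simp [hk, h k hk]
    rw [Finset.prod_eq_zero (Finset.mem_univ k), mul_zero]
    simp [modeFactor, hkj, hk]
  · intro l _
    rw [Finset.prod_eq_single j]
    · simp [modeFactor_self]
    · intro k _ hk
      simp [hk, modeFactor_of_ne]
    · simp

theorem bracket_one (X : Tensor n) : bracket X (fun j => (1 : Matrix (Fin (n j)) _ ℂ)) = X := by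
  funext i
  simp only [bracket]
  rw [Finset.sum_eq_single i]
  · simp
  · intro a _ ha
    obtain ⟨k, hk⟩ := Function.ne_iff.mp ha
    rw [Finset.prod_eq_zero (Finset.mem_univ k), mul_zero]
    simp [hk.symm]
  · simp

theorem bracket_sub (C D : Tensor t) (U : ∀ j, Matrix (Fin (n j)) (Fin (t j)) ℂ) :
    bracket (C - D) U = bracket C U - bracket D U := by
  funext i
  simp [bracket, sub_mul, Finset.sum_sub_distrib]

theorem bracket_sum {ι : Type*} (s : Finset ι) (C : ι → Tensor t)
    (U : ∀ j, Matrix (Fin (n j)) (Fin (t j)) ℂ) :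
    bracket (∑ a ∈ s, C a) U = ∑ a ∈ s, bracket (C a) U := by
  funext i
  simp only [bracket, Finset.sum_apply, Finset.sum_mul]
  rw [Finset.sum_comm]

/-! ### Frobenius geometry and orthogonal projections -/

/-- The Hermitian inner product of tensors, antilinear in the first argument. -/
noncomputable def frobeniusInner (X Y : Tensor n) : ℂ := ∑ i, star (X i) * Y i

theorem frobeniusInner_self (X : Tensor n) :
    frobeniusInner X X = ((frobeniusNorm X ^ 2 : ℝ) : ℂ) := by
  rw [frobeniusNorm, Real.sq_sqrt (Finset.sum_nonneg fun _ _ => sq_nonneg _)]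
  push_cast
  refine Finset.sum_congr rfl fun i _ => ?_
  rw [← Complex.conj_mul']
  rfl

theorem frobeniusInner_bracket (C : Tensor t) (U : ∀ j, Matrix (Fin (n j)) (Fin (t j)) ℂ)
    (Y : Tensor n) :
    frobeniusInner (bracket C U) Y = frobeniusInner C (bracket Y fun j => (U j)ᴴ) := by
  simp only [frobeniusInner, bracket, star_sum, Finset.sum_mul, Finset.mul_sum]
  rw [Finset.sum_comm]
  refine Finset.sum_congr rfl fun a _ => Finset.sum_congr rfl fun i _ => ?_
  simp only [star_mul', star_prod, Matrix.conjTranspose_apply]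
  ring

theorem frobeniusNorm_nonneg (X : Tensor n) : 0 ≤ frobeniusNorm X := Real.sqrt_nonneg _

theorem frobeniusNorm_sq (X : Tensor n) : frobeniusNorm X ^ 2 = ∑ i, ‖X i‖ ^ 2 :=
  Real.sq_sqrt (Finset.sum_nonneg fun _ _ => sq_nonneg _)

theorem frobeniusNorm_bracket_of_isometry (C : Tensor t)
    (U : ∀ j, Matrix (Fin (n j)) (Fin (t j)) ℂ) (hU : ∀ j, (U j)ᴴ * U j = 1) :
    frobeniusNorm (bracket C U) = frobeniusNorm C := by
  have h := frobeniusInner_bracket C U (bracket C U)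
  rw [bracket_bracket] at h
  simp only [hU] at h
  rw [bracket_one, frobeniusInner_self, frobeniusInner_self] at h
  exact (sq_eq_sq₀ (frobeniusNorm_nonneg _) (frobeniusNorm_nonneg _)).mp (by exact_mod_cast h)

theorem frobeniusNorm_sq_add (X Y : Tensor n) (h : frobeniusInner X Y = 0) :
    frobeniusNorm (X + Y) ^ 2 = frobeniusNorm X ^ 2 + frobeniusNorm Y ^ 2 := by
  have h' : frobeniusInner Y X = 0 := by
    have : frobeniusInner Y X = star (frobeniusInner X Y) := by
      simp only [frobeniusInner, star_sum, star_mul', star_star]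
      exact Finset.sum_congr rfl fun i _ => mul_comm _ _
    rw [this, h, star_zero]
  have key : frobeniusInner (X + Y) (X + Y) = frobeniusInner X X + frobeniusInner Y Y := by
    have : frobeniusInner (X + Y) (X + Y) = frobeniusInner X X + frobeniusInner X Y
        + frobeniusInner Y X + frobeniusInner Y Y := by
      simp only [frobeniusInner, ← Finset.sum_add_distrib]
      refine Finset.sum_congr rfl fun i _ => ?_
      simp only [Pi.add_apply, star_add]
      ring
    rw [this, h, h']; ring
  simp only [frobeniusInner_self] at key
  exact_mod_cast key

/-- A mode-`j` projection splits the Frobenius norm orthogonally. -/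
theorem frobeniusNorm_sub_add_modeProduct (X Y : Tensor n) (j : Fin d)
    (P : Matrix (Fin (n j)) (Fin (n j)) ℂ) (hP : Pᴴ = P) (hP2 : P * P = P) :
    frobeniusNorm ((X - modeProduct X j P) + modeProduct Y j P) ^ 2 =
      frobeniusNorm (X - modeProduct X j P) ^ 2 + frobeniusNorm (modeProduct Y j P) ^ 2 := by
  rw [add_comm, frobeniusNorm_sq_add, add_comm]
  have hc : (fun k => (modeFactor (n := n) j P k)ᴴ) = modeFactor j P := by
    funext k
    by_cases hk : k = j
    · subst hk; simp [modeFactor_self, hP]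
    · simp [hk, modeFactor_of_ne]
  have h2 : (fun k => modeFactor (n := n) j P k * modeFactor j P k) = modeFactor j P := by
    funext k
    by_cases hk : k = j
    · subst hk; simp [modeFactor_self, hP2]
    · simp [hk, modeFactor_of_ne]
  simp only [← bracket_modeFactor]
  -- Moving the self-adjoint `P` across the inner product leaves `P X - P² X = 0`.
  rw [frobeniusInner_bracket, hc, bracket_sub, bracket_bracket, h2, sub_self]
  simp [frobeniusInner]

theorem frobeniusNorm_sub_modeProduct_le (X : Tensor n) (j : Fin d)
    (P : Matrix (Fin (n j)) (Fin (n j)) ℂ) (hP : Pᴴ = P) (hP2 : P * P = P) :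
    frobeniusNorm (X - modeProduct X j P) ≤ frobeniusNorm X := by
  have h := frobeniusNorm_sub_add_modeProduct X X j P hP hP2
  rw [sub_add_cancel] at h
  refine (sq_le_sq₀ (frobeniusNorm_nonneg _) (frobeniusNorm_nonneg _)).mp ?_
  nlinarith [sq_nonneg (frobeniusNorm (modeProduct X j P))]

theorem frobeniusNorm_modeProduct_le (X : Tensor n) (j : Fin d)
    (P : Matrix (Fin (n j)) (Fin (n j)) ℂ) (hP : Pᴴ = P) (hP2 : P * P = P) :
    frobeniusNorm (modeProduct X j P) ^ 2 ≤ frobeniusNorm X ^ 2 := by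
  have h := frobeniusNorm_sub_add_modeProduct X X j P hP hP2
  rw [sub_add_cancel] at h
  nlinarith [sq_nonneg (frobeniusNorm (X - modeProduct X j P))]

/-- The quasi-optimality of the truncated higher-order singular value decomposition. -/
theorem frobeniusNorm_sub_bracket_sq_le (X : Tensor n)
    (P : ∀ j, Matrix (Fin (n j)) (Fin (n j)) ℂ) (hP : ∀ j, (P j)ᴴ = P j)
    (hP2 : ∀ j, P j * P j = P j) (s : Finset (Fin d)) :
    frobeniusNorm (X - bracket X fun j => if j ∈ s then P j else 1) ^ 2 ≤
      ∑ j ∈ s, frobeniusNorm (X - modeProduct X j (P j)) ^ 2 := by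
  induction s using Finset.induction_on with
  | empty => simp [bracket_one, frobeniusNorm]
  | insert a s ha ih =>
    rw [Finset.sum_insert ha]
    have hb : bracket X (fun j => if j ∈ insert a s then P j else 1) =
        modeProduct (bracket X fun j => if j ∈ s then P j else 1) a (P a) := by
      rw [← bracket_modeFactor, bracket_bracket]
      congr 1
      funext k
      by_cases hk : k = a
      · subst hk; simp [ha, modeFactor_self]
      · simp [hk, modeFactor_of_ne]
    -- Orthogonal splitting: the second summand is a projection of the error for `s`, so it is no
    -- larger than that error.
    have hs : X - bracket X (fun j => if j ∈ insert a s then P j else 1) =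
        (X - modeProduct X a (P a)) +
          modeProduct (X - bracket X fun j => if j ∈ s then P j else 1) a (P a) := by
      rw [hb, ← bracket_modeFactor (X - _), bracket_sub, bracket_modeFactor, bracket_modeFactor]
      abel
    rw [hs, frobeniusNorm_sub_add_modeProduct _ _ _ _ (hP a) (hP2 a)]
    have := frobeniusNorm_modeProduct_le (X - bracket X fun j => if j ∈ s then P j else 1) a (P a)
      (hP a) (hP2 a)
    linarith

/-- The mode-`j` fibres of `⟦C; U⟧` lie in the column space of `U j`. -/
theorem exists_bracket_eq_sum_mode (C : Tensor t) (U : ∀ j, Matrix (Fin (n j)) (Fin (t j)) ℂ)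
    (j : Fin d) : ∃ h : Fin (t j) → Tensor n,
      (∀ b i l, h b (Function.update i j l) = h b i) ∧
        ∀ i, bracket C U i = ∑ b, U j (i j) b * h b i := by
  -- Collect the core terms with `a j = b` and drop the mode-`j` factor, which removes the
  -- dependence on `i j`.
  refine ⟨fun b i => ∑ a, if a j = b then C a * ∏ k ∈ Finset.univ.erase j, U k (i k) (a k) else 0,
    ?_, ?_⟩
  · intro b i l
    refine Finset.sum_congr rfl fun a _ => ?_
    congr 2
    refine Finset.prod_congr rfl fun k hk => ?_
    rw [Function.update_of_ne (Finset.ne_of_mem_erase hk)]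
  · intro i
    simp only [Finset.mul_sum]
    rw [Finset.sum_comm]
    refine Finset.sum_congr rfl fun a _ => ?_
    simp only [mul_ite, mul_zero, Finset.sum_ite_eq, Finset.mem_univ, if_true]
    rw [← Finset.mul_prod_erase _ _ (Finset.mem_univ j)]
    ring

/-! ### Orthonormal bases and unitary diagonalization -/

/-- The matrix whose columns are the vectors of an orthonormal basis. -/
noncomputable def columnMatrix {n : ℕ} (b : OrthonormalBasis (Fin n) ℂ (EuclideanSpace ℂ (Fin n))) :
    Matrix (Fin n) (Fin n) ℂ :=
  Matrix.of fun k i => b i k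

theorem conjTranspose_columnMatrix_mul {n r : ℕ}
    (b : OrthonormalBasis (Fin n) ℂ (EuclideanSpace ℂ (Fin n))) (W : Matrix (Fin n) (Fin r) ℂ)
    (i : Fin n) (j : Fin r) :
    ((columnMatrix b)ᴴ * W) i j = inner ℂ (b i) (WithLp.toLp 2 (Wᵀ j)) := by
  rw [EuclideanSpace.inner_eq_star_dotProduct, Matrix.mul_apply, dotProduct]
  exact Finset.sum_congr rfl fun k _ => mul_comm _ _

theorem conjTranspose_columnMatrix_mul_self {n : ℕ}
    (b : OrthonormalBasis (Fin n) ℂ (EuclideanSpace ℂ (Fin n))) :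
    (columnMatrix b)ᴴ * columnMatrix b = 1 := by
  ext i j
  rw [conjTranspose_columnMatrix_mul, Matrix.one_apply]
  exact orthonormal_iff_ite.mp b.orthonormal i j

/-- The columns of a matrix with `r` columns lie in the range of an isometry of rank `min r n`. -/
theorem exists_isometry_mul_conjTranspose_mul_eq {n r : ℕ} (W : Matrix (Fin n) (Fin r) ℂ) :
    ∃ U : Matrix (Fin n) (Fin (min r n)) ℂ, Uᴴ * U = 1 ∧ U * Uᴴ * W = W := by
  -- The first `min r n` columns of `W`, padded with zeros. Gram–Schmidt gives a full orthonormal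
  -- basis even if they are dependent.
  let f : Fin n → EuclideanSpace ℂ (Fin n) := fun i =>
    if h : (i : ℕ) < r then WithLp.toLp 2 (Wᵀ ⟨i, h⟩) else 0
  let b := InnerProductSpace.gramSchmidtOrthonormalBasis (𝕜 := ℂ) (by simp) f
  let c : Fin (min r n) → Fin n := Fin.castLE (min_le_right r n)
  have hc : Function.Injective c := Fin.castLE_injective _
  have hV := conjTranspose_columnMatrix_mul_self b
  refine ⟨(columnMatrix b).submatrix id c, ?_, ?_⟩
  · ext i j
    have := congrFun (congrFun hV (c i)) (c j)
    simpa [Matrix.mul_apply, Matrix.one_apply, hc.eq_iff] using this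
  · have hV' : columnMatrix b * ((columnMatrix b)ᴴ * W) = W := by
      rw [← Matrix.mul_assoc, mul_eq_one_comm.mp hV, Matrix.one_mul]
    rw [Matrix.mul_assoc]
    conv_rhs => rw [← hV']
    ext k β
    rw [Matrix.mul_apply, Matrix.mul_apply]
    refine Finset.sum_of_injOn c hc.injOn (by simp) ?_ ?_
    · intro j _ hj
      have hrj : r ≤ (j : ℕ) := by
        by_contra! h
        exact hj ⟨⟨j, lt_min h j.2⟩, by simp, rfl⟩
      have hβ : (β : ℕ) < n := by omega
      have hf : f ⟨β, hβ⟩ = WithLp.toLp 2 (Wᵀ β) := by simp [f]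
      -- Column `β < r ≤ j` has no component along `b j`, by triangularity.
      rw [conjTranspose_columnMatrix_mul, ← hf,
        InnerProductSpace.gramSchmidtOrthonormalBasis_inv_triangular _ _ (Fin.lt_def.mpr (by simp; omega)), mul_zero]
    · intro j _
      simp [Matrix.mul_apply]

/-- A normal matrix is unitarily diagonalizable. -/
theorem exists_unitary_diagonalization {n : ℕ} (A : Matrix (Fin n) (Fin n) ℂ)
    (hA : IsStarNormal A) :
    ∃ (V : Matrix (Fin n) (Fin n) ℂ) (a : Fin n → ℂ),
      Vᴴ * V = 1 ∧ Vᴴ * A * V = Matrix.diagonal a ∧ ∀ i, a i ∈ spectrum ℂ A := by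
  -- Normality makes the Hermitian real and imaginary parts commute, so their joint eigenspaces
  -- span.
  let H : Matrix (Fin n) (Fin n) ℂ := (realPart A : Matrix (Fin n) (Fin n) ℂ)
  let K : Matrix (Fin n) (Fin n) ℂ := (imaginaryPart A : Matrix (Fin n) (Fin n) ℂ)
  have hHK : H + Complex.I • K = A := realPart_add_I_smul_imaginaryPart A
  have hH : (Matrix.toEuclideanLin H).IsSymmetric :=
    Matrix.isSymmetric_toEuclideanLin_iff.mpr (realPart A).2
  have hK : (Matrix.toEuclideanLin K).IsSymmetric :=
    Matrix.isSymmetric_toEuclideanLin_iff.mpr (imaginaryPart A).2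
  have hcomm : Commute (Matrix.toEuclideanLin H) (Matrix.toEuclideanLin K) := by
    have h : H * K = K * H := Commute.realPart_imaginaryPart A
    have h' := congrArg (Matrix.toLpLin 2 2) h
    rwa [Matrix.toLpLin_mul_same, Matrix.toLpLin_mul_same] at h'
  let S : ℂ × ℂ → Submodule ℂ (EuclideanSpace ℂ (Fin n)) := fun i =>
    Module.End.eigenspace (Matrix.toEuclideanLin H) i.2 ⊓
      Module.End.eigenspace (Matrix.toEuclideanLin K) i.1
  have hS : OrthogonalFamily ℂ (fun i => S i) fun i => (S i).subtypeₗᵢ :=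
    LinearMap.IsSymmetric.orthogonalFamily_eigenspace_inf_eigenspace hH hK
  have htop : ⨆ i, S i = ⊤ := by
    rw [iSup_prod, iSup_comm]
    exact LinearMap.IsSymmetric.iSup_iSup_eigenspace_inf_eigenspace_eq_top_of_commute hH hK hcomm
  -- Only finitely many joint eigenspaces are nonzero; dropping the others gives a finite index
  -- type.
  have : Fintype {i // S i ≠ ⊥} :=
    (WellFoundedGT.finite_ne_bot_of_iSupIndep hS.independent).fintype
  let S' : {i // S i ≠ ⊥} → Submodule ℂ (EuclideanSpace ℂ (Fin n)) := fun i => S i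
  have hS' : OrthogonalFamily ℂ (fun i => S' i) fun i => (S' i).subtypeₗᵢ :=
    hS.comp Subtype.coe_injective
  have hint : DirectSum.IsInternal S' := by
    change DirectSum.IsInternal fun i : {i // S i ≠ ⊥} => S i
    rw [OrthogonalFamily.isInternal_iff hS', iSup_ne_bot_subtype, htop, Submodule.top_orthogonal_eq_bot]
  let b := hint.subordinateOrthonormalBasis (n := n) (by simp) hS'
  let x : Fin n → ℂ × ℂ := fun a =>
    (hint.subordinateOrthonormalBasisIndex (n := n) (by simp) a hS').1
  have hb : ∀ i, b i ∈ S (x i) := fun i =>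
    hint.subordinateOrthonormalBasis_subordinate (n := n) (by simp) i hS'
  let a : Fin n → ℂ := fun i => (x i).2 + Complex.I * (x i).1
  have hV := conjTranspose_columnMatrix_mul_self b
  have hAV : A * columnMatrix b = columnMatrix b * Matrix.diagonal a := by
    ext k i
    obtain ⟨h1, h2⟩ := hb i
    rw [SetLike.mem_coe, Module.End.mem_eigenspace_iff] at h1 h2
    have h1' := congrFun (congrArg WithLp.ofLp h1) k
    have h2' := congrFun (congrArg WithLp.ofLp h2) k
    simp only [Matrix.toLpLin_apply, Matrix.mulVec, dotProduct, PiLp.smul_apply, smul_eq_mul]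
      at h1' h2'
    rw [Matrix.mul_diagonal, ← hHK, Matrix.add_mul, Matrix.smul_mul, Matrix.add_apply,
      Matrix.smul_apply, Matrix.mul_apply, Matrix.mul_apply]
    simp only [columnMatrix, Matrix.of_apply, smul_eq_mul, h1', h2', a]
    ring
  have hdiag : (columnMatrix b)ᴴ * A * columnMatrix b = Matrix.diagonal a := by
    rw [Matrix.mul_assoc, hAV, ← Matrix.mul_assoc, hV, Matrix.one_mul]
  refine ⟨columnMatrix b, a, hV, hdiag, fun i => ?_⟩
  let u : (Matrix (Fin n) (Fin n) ℂ)ˣ :=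
    ⟨(columnMatrix b)ᴴ, columnMatrix b, hV, mul_eq_one_comm.mp hV⟩
  have hu : spectrum ℂ (Matrix.diagonal a) = spectrum ℂ A := by
    rw [← hdiag]
    exact spectrum.units_conjugate (u := u)
  rw [← hu, spectrum_diagonal]
  exact Set.mem_range_self i

/-! ### Rational functions and Bezout's kernel -/

/-- Bezout's kernel: `p(x) q(y) - q(x) p(y)` is `x - y` times a polynomial of degree less than `k`
in `x`. -/
theorem exists_bezout_kernel {p q : Polynomial ℂ} {k : ℕ} (hp : p.natDegree ≤ k)
    (hq : q.natDegree ≤ k) :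
    ∃ c : Fin k → ℂ → ℂ, ∀ x y, p.eval x * q.eval y - q.eval x * p.eval y =
      (x - y) * ∑ s : Fin k, x ^ (s : ℕ) * c s y := by
  let f : ℂ → Polynomial ℂ := fun y =>
    Polynomial.C (q.eval y) * p - Polynomial.C (p.eval y) * q
  refine ⟨fun s y => (f y /ₘ (Polynomial.X - Polynomial.C y)).coeff s, fun x y => ?_⟩
  have hroot : (f y).IsRoot y := by simp [f, Polynomial.IsRoot, mul_comm]
  have hmul := Polynomial.mul_divByMonic_eq_iff_isRoot.mpr hroot
  set g := f y /ₘ (Polynomial.X - Polynomial.C y) with hgdef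
  have hx : p.eval x * q.eval y - q.eval x * p.eval y = (x - y) * g.eval x := by
    have := congrArg (Polynomial.eval x) hmul
    simp only [f, Polynomial.eval_mul, Polynomial.eval_sub, Polynomial.eval_X,
      Polynomial.eval_C] at this
    rw [this]; ring
  rw [hx]
  congr 1
  -- For `k = 0` the quotient is zero, and its `natDegree` is not below `k`.
  rcases eq_or_ne g 0 with hg | hg
  · simp [← hgdef, hg]
  have hfd : (f y).natDegree ≤ k := (Polynomial.natDegree_sub_le _ _).trans
    (max_le ((Polynomial.natDegree_C_mul_le _ _).trans hp)
      ((Polynomial.natDegree_C_mul_le _ _).trans hq))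
  have hgk : g.natDegree < k := by
    rw [← hmul, Polynomial.natDegree_mul (Polynomial.X_sub_C_ne_zero y) hg,
      Polynomial.natDegree_X_sub_C] at hfd
    omega
  rw [Polynomial.eval_eq_sum_range' hgk, Finset.sum_range]
  exact Finset.sum_congr rfl fun s _ => mul_comm _ _

theorem denom_eval_ne_zero_of_ratAbs_ne_top {r : RatFunc ℂ} {z : ℂ} (h : ratAbs r z ≠ ∞) :
    r.denom.eval z ≠ 0 := by
  intro hz
  have hn : r.num.eval z ≠ 0 := by
    obtain ⟨u, v, huv⟩ := r.isCoprime_num_denom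
    intro hn
    have := congrArg (Polynomial.eval z) huv
    simp [hz, hn] at this
  exact h (by simp [ratAbs, hz, ENNReal.div_zero, hn])

theorem num_eval_ne_zero_of_ratAbs_ne_zero {r : RatFunc ℂ} {z : ℂ} (h : ratAbs r z ≠ 0) :
    r.num.eval z ≠ 0 := by
  intro hz
  exact h (by simp [ratAbs, hz])

theorem enorm_div_of_ne_zero (a : ℂ) {b : ℂ} (hb : b ≠ 0) : ‖a / b‖ₑ = ‖a‖ₑ / ‖b‖ₑ := by
  rw [div_eq_mul_inv, enorm_mul, enorm_inv hb, div_eq_mul_inv]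

/-- Equality holds unless `y` is a pole of `r`, where the left side vanishes. Clearing denominators
thus allows poles in `F`. -/
theorem enorm_cross_ratio_le {r : RatFunc ℂ} {x y : ℂ} (hx : ratAbs r x ≠ ∞)
    (hy : ratAbs r y ≠ 0) :
    ‖r.num.eval x * r.denom.eval y / (r.denom.eval x * r.num.eval y)‖ₑ ≤
      ratAbs r x / ratAbs r y := by
  have hqx := denom_eval_ne_zero_of_ratAbs_ne_top hx
  have hpy := num_eval_ne_zero_of_ratAbs_ne_zero hy
  rcases eq_or_ne (r.denom.eval y) 0 with hqy | hqy
  · simp [hqy]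
  · rw [ratAbs, ratAbs, ← enorm_div_of_ne_zero _ hqx, ← enorm_div_of_ne_zero _ hqy,
      ← enorm_div_of_ne_zero _ (div_ne_zero hpy hqy)]
    apply le_of_eq
    congr 1
    field_simp

/-! ### Best projections in one mode -/

/-- Unit columns bound all entries by 1, and the defining equation is closed. Compactness provides a
best projection. -/
theorem isCompact_isometries (n t : ℕ) :
    IsCompact {U : Matrix (Fin n) (Fin t) ℂ | Uᴴ * U = 1} := by
  have hK : IsCompact (Set.univ.pi fun _ : Fin n => Set.univ.pi fun _ : Fin t =>
      Metric.closedBall (0 : ℂ) 1) :=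
    isCompact_univ_pi fun _ => isCompact_univ_pi fun _ => isCompact_closedBall 0 1
  refine hK.of_isClosed_subset (isClosed_eq (by fun_prop) continuous_const)
    fun (U : Matrix (Fin n) (Fin t) ℂ) (hU : Uᴴ * U = 1) => ?_
  suffices hUle : ∀ k l, ‖U k l‖ ≤ 1 from
    fun k _ l _ => mem_closedBall_zero_iff.mpr (hUle k l)
  intro k l
  have h : ∑ i, ‖U i l‖ ^ 2 = 1 := by
    have h := congrFun (congrFun hU l) l
    rw [Matrix.mul_apply, Matrix.one_apply_eq] at h
    have h' : ((∑ i, ‖U i l‖ ^ 2 : ℝ) : ℂ) = 1 := by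
      rw [← h]
      push_cast
      refine Finset.sum_congr rfl fun i _ => ?_
      rw [← Complex.conj_mul']
      rfl
    exact_mod_cast h'
  have h1 : ‖U k l‖ ^ 2 ≤ 1 := h ▸ Finset.single_le_sum (f := fun i => ‖U i l‖ ^ 2)
    (fun i _ => sq_nonneg _) (Finset.mem_univ k)
  exact (sq_le_one_iff₀ (norm_nonneg _)).mp h1

theorem conjTranspose_isometry_projection {n t : ℕ} (U : Matrix (Fin n) (Fin t) ℂ) :
    (U * Uᴴ)ᴴ = U * Uᴴ := by
  simp [Matrix.conjTranspose_mul]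

theorem isometry_projection_mul_self {n t : ℕ} {U : Matrix (Fin n) (Fin t) ℂ} (hU : Uᴴ * U = 1) :
    U * Uᴴ * (U * Uᴴ) = U * Uᴴ := by
  rw [Matrix.mul_assoc, ← Matrix.mul_assoc Uᴴ, hU, Matrix.one_mul]

/-- There is a best approximation of `X` by an orthogonal projection of rank `min r (n j)` in
mode `j`. It is at least as good as any tensor whose mode-`j` fibres lie in the span of `r`
vectors. -/
theorem exists_best_mode_projection (X : Tensor n) (j : Fin d) (r : ℕ) :
    ∃ U : Matrix (Fin (n j)) (Fin (min r (n j))) ℂ, Uᴴ * U = 1 ∧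
      ∀ (Y : Tensor n) (W : Matrix (Fin (n j)) (Fin r) ℂ) (h : Fin r → Tensor n),
        (∀ β i l, h β (Function.update i j l) = h β i) → (∀ i, Y i = ∑ β, W (i j) β * h β i) →
          frobeniusNorm (X - modeProduct X j (U * Uᴴ)) ≤ frobeniusNorm (X - Y) := by
  have hcont : Continuous fun U : Matrix (Fin (n j)) (Fin (min r (n j))) ℂ =>
      frobeniusNorm (X - modeProduct X j (U * Uᴴ)) := by
    unfold frobeniusNorm modeProduct
    simp only [Pi.sub_apply, Matrix.mul_apply, Matrix.conjTranspose_apply]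
    fun_prop
  -- The zero matrix serves only to show that the set of isometries is nonempty.
  obtain ⟨U₀, hU₀, -⟩ := exists_isometry_mul_conjTranspose_mul_eq
    (0 : Matrix (Fin (n j)) (Fin r) ℂ)
  obtain ⟨U, hU, hmin⟩ := (isCompact_isometries (n j) (min r (n j))).exists_isMinOn ⟨U₀, hU₀⟩
    hcont.continuousOn
  refine ⟨U, hU, fun Y W h hh hY => ?_⟩
  obtain ⟨V, hV, hVW⟩ := exists_isometry_mul_conjTranspose_mul_eq W
  refine (hmin hV).trans ?_
  have hYV : modeProduct Y j (V * Vᴴ) = Y := by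
    funext i
    have hWi : ∀ β, W (i j) β = ∑ l, (V * Vᴴ) (i j) l * W l β := fun β => by
      conv_lhs => rw [← hVW, Matrix.mul_apply]
    rw [hY i]
    simp only [modeProduct, hY, hh, Function.update_self, hWi (_ : Fin r), Finset.sum_mul]
    rw [Finset.sum_comm]
    refine Finset.sum_congr rfl fun β _ => Finset.sum_congr rfl fun l _ => ?_
    ring
  -- Since the projection fixes `Y`, the error for `X` is that for `X - Y`.
  have hsub : X - modeProduct X j (V * Vᴴ) = (X - Y) - modeProduct (X - Y) j (V * Vᴴ) := by
    rw [← bracket_modeFactor (X - Y), bracket_sub, bracket_modeFactor, bracket_modeFactor, hYV]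
    abel
  change frobeniusNorm (X - modeProduct X j (V * Vᴴ)) ≤ _
  rw [hsub]
  exact frobeniusNorm_sub_modeProduct_le _ _ _ (conjTranspose_isometry_projection V)
    (isometry_projection_mul_self hV)

/-! ### Low rank in one mode from a rational function -/

theorem frobeniusNorm_le_mul_of_forall_norm_le {X Y : Tensor n} {c : ℝ} (hc : 0 ≤ c)
    (h : ∀ i, ‖X i‖ ≤ c * ‖Y i‖) : frobeniusNorm X ≤ c * frobeniusNorm Y := by
  refine (sq_le_sq₀ (frobeniusNorm_nonneg _) (mul_nonneg hc (frobeniusNorm_nonneg _))).mp ?_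
  rw [mul_pow, frobeniusNorm_sq, frobeniusNorm_sq, Finset.mul_sum]
  refine Finset.sum_le_sum fun i _ => ?_
  rw [← mul_pow]
  exact pow_le_pow_left₀ (norm_nonneg _) (h i) 2

/-- The rational function `r` yields an approximation of `X` of low mode-`j` rank when
`(x (i j) - y i) * X i` has mode-`j` rank at most `μ` and `y i` does not depend on `i j`. -/
theorem exists_low_rank_approximation (X : Tensor n) (j : Fin d) (x : Fin (n j) → ℂ)
    (y : Tensor n) (hy : ∀ i l, y (Function.update i j l) = y i) {E F : Set ℂ}
    (hE : ∀ l, x l ∈ E) (hF : ∀ i, y i ∈ F) {μ : ℕ} (W : Matrix (Fin (n j)) (Fin μ) ℂ)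
    (g : Fin μ → Tensor n) (hg : ∀ b i l, g b (Function.update i j l) = g b i)
    (hG : ∀ i, (x (i j) - y i) * X i = ∑ b, W (i j) b * g b i) {k : ℕ} {r : RatFunc ℂ}
    (hp : r.num.natDegree ≤ k) (hq : r.denom.natDegree ≤ k)
    (hsup : (⨆ z ∈ E, ratAbs r z) ≠ ∞) (hinf : (⨅ z ∈ F, ratAbs r z) ≠ 0) :
    ∃ (Y : Tensor n) (W' : Matrix (Fin (n j)) (Fin (k * μ)) ℂ) (h : Fin (k * μ) → Tensor n),
      (∀ β i l, h β (Function.update i j l) = h β i) ∧ (∀ i, Y i = ∑ β, W' (i j) β * h β i) ∧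
        frobeniusNorm (X - Y) ≤
          ((⨆ z ∈ E, ratAbs r z) / (⨅ z ∈ F, ratAbs r z)).toReal * frobeniusNorm X := by
  obtain ⟨c, hc⟩ := exists_bezout_kernel hp hq
  have hxE : ∀ l, ratAbs r (x l) ≤ ⨆ z ∈ E, ratAbs r z := fun l =>
    le_iSup₂ (f := fun z _ => ratAbs r z) (x l) (hE l)
  have hyF : ∀ i, ⨅ z ∈ F, ratAbs r z ≤ ratAbs r (y i) := fun i =>
    iInf₂_le (f := fun z _ => ratAbs r z) (y i) (hF i)
  have hx0 : ∀ l, ratAbs r (x l) ≠ ∞ := fun l => ne_top_of_le_ne_top hsup (hxE l)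
  have hy0 : ∀ i, ratAbs r (y i) ≠ 0 := fun i h => hinf (le_antisymm (h ▸ hyF i) zero_le)
  let Y : Tensor n := fun i => X i - r.num.eval (x (i j)) * r.denom.eval (y i) /
    (r.denom.eval (x (i j)) * r.num.eval (y i)) * X i
  -- `β` encodes a pair: a power `s < k` in Bezout's kernel and a column `b` of `W`.
  let W' : Matrix (Fin (n j)) (Fin (k * μ)) ℂ := fun l β =>
    x l ^ ((finProdFinEquiv.symm β).1 : ℕ) / r.denom.eval (x l) * W l (finProdFinEquiv.symm β).2
  let h : Fin (k * μ) → Tensor n := fun β i =>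
    -(c (finProdFinEquiv.symm β).1 (y i) / r.num.eval (y i) * g (finProdFinEquiv.symm β).2 i)
  refine ⟨Y, W', h, fun β i l => by simp only [h, hy, hg], fun i => ?_, ?_⟩
  · have hqx := denom_eval_ne_zero_of_ratAbs_ne_top (hx0 (i j))
    have hpy := num_eval_ne_zero_of_ratAbs_ne_zero (hy0 i)
    have hsum : ∑ β, W' (i j) β * h β i =
        -((∑ s : Fin k, x (i j) ^ (s : ℕ) * c s (y i)) * ∑ b, W (i j) b * g b i) /
          (r.denom.eval (x (i j)) * r.num.eval (y i)) := by
      rw [← finProdFinEquiv.sum_comp, Fintype.sum_prod_type, Finset.sum_mul_sum,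
        ← Finset.sum_neg_distrib, Finset.sum_div]
      refine Finset.sum_congr rfl fun s _ => ?_
      rw [← Finset.sum_neg_distrib, Finset.sum_div]
      refine Finset.sum_congr rfl fun b _ => ?_
      simp only [W', h, Equiv.symm_apply_apply]
      field_simp
    rw [hsum, ← hG, ← mul_assoc, mul_comm (∑ s : Fin k, _), ← hc]
    simp only [Y]
    field_simp
    ring
  · refine frobeniusNorm_le_mul_of_forall_norm_le ENNReal.toReal_nonneg fun i => ?_
    have hXY : (X - Y) i = r.num.eval (x (i j)) * r.denom.eval (y i) /
        (r.denom.eval (x (i j)) * r.num.eval (y i)) * X i := by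
      simp [Y]
    rw [hXY, norm_mul]
    refine mul_le_mul_of_nonneg_right ?_ (norm_nonneg _)
    rw [← toReal_enorm]
    exact ENNReal.toReal_mono (ENNReal.div_ne_top hsup hinf)
      ((enorm_cross_ratio_le (hx0 (i j)) (hy0 i)).trans (ENNReal.div_le_div (hxE _) (hyF i)))

/-- The infimum defining `Z_k` need not be attained. The best `U` is therefore fixed before `r` and
compared with every admissible `r`. -/
theorem exists_mode_projection_of_zolotarev_le (X : Tensor n) (j : Fin d) (x : Fin (n j) → ℂ)
    (y : Tensor n) (hy : ∀ i l, y (Function.update i j l) = y i) {E F : Set ℂ}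
    (hE : ∀ l, x l ∈ E) (hF : ∀ i, y i ∈ F) {μ : ℕ} (W : Matrix (Fin (n j)) (Fin μ) ℂ)
    (g : Fin μ → Tensor n) (hg : ∀ b i l, g b (Function.update i j l) = g b i)
    (hG : ∀ i, (x (i j) - y i) * X i = ∑ b, W (i j) b * g b i) {k : ℕ} {δ : ℝ} (hδ : 0 ≤ δ)
    (hk : zolotarev k E F ≤ ENNReal.ofReal δ) :
    ∃ U : Matrix (Fin (n j)) (Fin (min (k * μ) (n j))) ℂ, Uᴴ * U = 1 ∧
      frobeniusNorm (X - modeProduct X j (U * Uᴴ)) ≤ δ * frobeniusNorm X := by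
  obtain ⟨U, hU, hbest⟩ := exists_best_mode_projection X j (k * μ)
  refine ⟨U, hU, ?_⟩
  -- The relative error is compared below, so `X = 0` is separate.
  rcases (frobeniusNorm_nonneg X).eq_or_lt with h0 | h0
  · rw [← h0, mul_zero, h0]
    exact frobeniusNorm_sub_modeProduct_le _ _ _ (conjTranspose_isometry_projection U)
      (isometry_projection_mul_self hU)
  · rw [← div_le_iff₀ h0, ← ENNReal.ofReal_le_ofReal_iff hδ]
    refine le_trans ?_ hk
    refine le_iInf fun r => le_iInf fun hp => le_iInf fun hq => le_iInf fun hsup =>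
      le_iInf fun hinf => ENNReal.ofReal_le_of_le_toReal ?_
    obtain ⟨Y, W', h, hh, hY, hle⟩ :=
      exists_low_rank_approximation X j x y hy hE hF W g hg hG hp hq hsup hinf
    exact (div_le_iff₀ h0).mpr ((hbest Y W' h hh hY).trans hle)

/-! ### Combining the modes -/

/-- Truncation of the higher-order singular value decomposition. -/
theorem exists_tucker_of_mode_projections (X : Tensor n) {ε : ℝ} (hε : 0 ≤ ε)
    (U : ∀ j, Matrix (Fin (n j)) (Fin (t j)) ℂ) (hU : ∀ j, (U j)ᴴ * U j = 1)
    (h : ∀ j, frobeniusNorm (X - modeProduct X j (U j * (U j)ᴴ)) ≤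
      ε / Real.sqrt d * frobeniusNorm X) :
    ∃ Y : Tensor n, frobeniusNorm (X - Y) ≤ ε * frobeniusNorm X ∧ HasOrthogonalTucker Y t := by
  refine ⟨bracket (bracket X fun j => (U j)ᴴ) U, ?_, _, U, hU, rfl⟩
  have hsum := frobeniusNorm_sub_bracket_sq_le X (fun j => U j * (U j)ᴴ)
    (fun j => conjTranspose_isometry_projection _) (fun j => isometry_projection_mul_self (hU j))
    Finset.univ
  simp only [Finset.mem_univ, if_true] at hsum
  rw [bracket_bracket]
  refine (sq_le_sq₀ (frobeniusNorm_nonneg _) (mul_nonneg hε (frobeniusNorm_nonneg _))).mp ?_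
  refine hsum.trans ((Finset.sum_le_sum fun j _ =>
    pow_le_pow_left₀ (frobeniusNorm_nonneg _) (h j) 2).trans ?_)
  rw [Finset.sum_const, Finset.card_univ, Fintype.card_fin, nsmul_eq_mul, mul_pow, div_pow,
    Real.sq_sqrt (Nat.cast_nonneg d), mul_pow]
  -- For `d = 0` the sum of errors is empty; otherwise `d * (ε/√d)^2 = ε^2`.
  rcases Nat.eq_zero_or_pos d with rfl | hd
  · simp only [Nat.cast_zero, zero_mul]
    positivity
  · have : (d : ℝ) ≠ 0 := by positivity
    apply le_of_eq
    field_simp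

theorem HasOrthogonalTucker.bracket_of_isometry {Y : Tensor n} (hY : HasOrthogonalTucker Y t)
    {V : ∀ j, Matrix (Fin (m j)) (Fin (n j)) ℂ} (hV : ∀ j, (V j)ᴴ * V j = 1) :
    HasOrthogonalTucker (bracket Y V) t := by
  obtain ⟨C, U, hU, rfl⟩ := hY
  refine ⟨C, fun j => V j * U j, fun j => ?_, bracket_bracket _ _ _⟩
  rw [Matrix.conjTranspose_mul, Matrix.mul_assoc, ← Matrix.mul_assoc (V j)ᴴ, hV, Matrix.one_mul,
    hU]

theorem exists_hasOrthogonalTucker_eq_multilinearRank (G : Tensor n) (j : Fin d) :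
    ∃ t : Fin d → ℕ, HasOrthogonalTucker G t ∧ t j = multilinearRank G j :=
  Nat.sInf_mem (s := {r | ∃ t : Fin d → ℕ, HasOrthogonalTucker G t ∧ t j = r})
    ⟨n j, n, ⟨G, fun _ => 1, fun _ => by simp, (bracket_one G).symm⟩, rfl⟩

theorem modeProduct_diagonal (X : Tensor n) (j : Fin d) (a : Fin (n j) → ℂ)
    (i : ∀ j, Fin (n j)) : modeProduct X j (Matrix.diagonal a) i = a (i j) * X i := by
  rw [modeProduct, Finset.sum_eq_single (i j)]
  · simp [mul_comm]
  · intro l _ hl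
    simp [hl.symm]
  · simp

/-- Outside mode `j` the factors `(V k)ᴴ * V k` cancel. -/
theorem bracket_modeProduct_bracket_unitary (X : Tensor n) (j : Fin d)
    (V : ∀ j, Matrix (Fin (n j)) (Fin (n j)) ℂ) (hV : ∀ j, (V j)ᴴ * V j = 1)
    (A : Matrix (Fin (n j)) (Fin (n j)) ℂ) :
    bracket (modeProduct (bracket X V) j A) (fun k => (V k)ᴴ) =
      modeProduct X j ((V j)ᴴ * A * V j) := by
  rw [← bracket_modeFactor, ← bracket_modeFactor, bracket_bracket, bracket_bracket]
  congr 1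
  funext k
  by_cases hk : k = j
  · subst hk; simp [modeFactor_self, Matrix.mul_assoc]
  · simp [hk, modeFactor_of_ne, hV]

/-- Tensors with displacement structure have approximations of low multilinear rank. -/
theorem exists_tucker_approximation (X G : Tensor n)
    (A : ∀ j, Matrix (Fin (n j)) (Fin (n j)) ℂ) (E F : Fin d → Set ℂ)
    (hA : MinkowskiSinglySeparated A E F) (hX : ∑ j, modeProduct X j (A j) = G)
    {ε : ℝ} (hε : 0 ≤ ε) (k : Fin d → ℕ)
    (hk : ∀ j, zolotarev (k j) (E j) (F j) ≤ ENNReal.ofReal (ε / Real.sqrt d)) :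
    ∃ (Y : Tensor n) (t : Fin d → ℕ), frobeniusNorm (X - Y) ≤ ε * frobeniusNorm X ∧
      HasOrthogonalTucker Y t ∧ ∀ j, t j ≤ k j * multilinearRank G j := by
  choose V a hV hVA ha using fun j => exists_unitary_diagonalization (A j) (hA.normal j)
  let X' : Tensor n := bracket X fun j => (V j)ᴴ
  have hXX' : X = bracket X' V := by
    rw [bracket_bracket, funext fun j => mul_eq_one_comm.mp (hV j), bracket_one]
  have hG' : ∀ i, (∑ j, a j (i j)) * X' i = bracket G (fun j => (V j)ᴴ) i := fun i => by
    rw [← hX, bracket_sum, Finset.sum_apply, Finset.sum_mul]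
    refine Finset.sum_congr rfl fun j _ => ?_
    rw [hXX', bracket_modeProduct_bracket_unitary _ _ _ hV, hVA, modeProduct_diagonal]
  have hproj : ∀ j, ∃ U : Matrix (Fin (n j)) (Fin (min (k j * multilinearRank G j) (n j))) ℂ,
      Uᴴ * U = 1 ∧ frobeniusNorm (X' - modeProduct X' j (U * Uᴴ)) ≤
        ε / Real.sqrt d * frobeniusNorm X' := fun j => by
    -- The decomposition may depend on `j`: only its size in mode `j` matters here.
    obtain ⟨t, ⟨C, U, -, hGC⟩, ht⟩ := exists_hasOrthogonalTucker_eq_multilinearRank G j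
    rw [← ht]
    obtain ⟨g, hg, hGg⟩ := exists_bracket_eq_sum_mode C (fun j => (V j)ᴴ * U j) j
    refine exists_mode_projection_of_zolotarev_le X' j (a j)
      -- With this `y`, the difference `x - y` is the full eigenvalue sum in `hG'`.
      (fun i => -∑ k ∈ Finset.univ.erase j, a k (i k)) (fun i l => ?_)
      (fun l => hA.spectrum_subset j (ha j l)) (fun i => hA.neg_sum_subset j ?_)
      ((V j)ᴴ * U j) g hg (fun i => ?_) (by positivity) (hk j)
    · congr 1
      refine Finset.sum_congr rfl fun k hk => ?_
      rw [Function.update_of_ne (Finset.ne_of_mem_erase hk)]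
    · exact Set.neg_mem_neg.mpr (Set.finsetSum_mem_finsetSum _ _ _ fun k _ => ha k (i k))
    · rw [← hGg, ← bracket_bracket, ← hGC, ← hG', sub_neg_eq_add,
        Finset.add_sum_erase _ (fun k => a k (i k)) (Finset.mem_univ j)]
  choose U hU hUX using hproj
  obtain ⟨Y, hY, hYt⟩ := exists_tucker_of_mode_projections X' hε U hU hUX
  refine ⟨bracket Y V, _, ?_, hYt.bracket_of_isometry hV, fun j => min_le_left _ _⟩
  rwa [hXX', ← bracket_sub, frobeniusNorm_bracket_of_isometry _ _ hV,
    frobeniusNorm_bracket_of_isometry _ _ hV]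

theorem tuckerStorage_mono {s : Fin d → ℕ} (h : ∀ j, t j ≤ s j) :
    tuckerStorage n t ≤ tuckerStorage n s :=
  add_le_add (Finset.sum_le_sum fun j _ => Nat.mul_le_mul_left _ (h j))
    (Finset.prod_le_prod' fun j _ => h j)

end TuckerDisplacement

theorem mainTheorem3 {d : ℕ} {n : Fin d → ℕ}
    (X G : TuckerDisplacement.Tensor n)
    (A : ∀ j, Matrix (Fin (n j)) (Fin (n j)) ℂ) (E F : Fin d → Set ℂ)
    (hA : TuckerDisplacement.MinkowskiSinglySeparated A E F)
    (hX : ∑ j, TuckerDisplacement.modeProduct X j (A j) = G)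
    (ε : ℝ) (hε0 : 0 < ε) (hε1 : ε < 1)
    (μ : Fin d → ℕ) (hμ : TuckerDisplacement.multilinearRank G = μ)
    (k : Fin d → ℕ)
    (hk : ∀ j, TuckerDisplacement.zolotarev (k j) (E j) (F j) ≤ ENNReal.ofReal (ε / Real.sqrt d)) :
    (∃ (Y : TuckerDisplacement.Tensor n) (t : Fin d → ℕ),
      TuckerDisplacement.frobeniusNorm (X - Y) ≤ ε * TuckerDisplacement.frobeniusNorm X ∧
      TuckerDisplacement.HasOrthogonalTucker Y t ∧ ∀ j, t j ≤ k j * μ j) ∧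
    TuckerDisplacement.tuckerCompressibility ε X ≤
      ∑ j, n j * (k j * μ j) + ∏ j, k j * μ j := by
  subst hμ
  have h := TuckerDisplacement.exists_tucker_approximation X G A E F hA hX hε0.le k hk
  refine ⟨h, ?_⟩
  obtain ⟨Y, t, hY, hYt, ht⟩ := h
  have hmem : TuckerDisplacement.tuckerCompressibility ε X ≤ TuckerDisplacement.tuckerStorage n t :=
    Nat.sInf_le ⟨Y, t, hY, hYt, rfl⟩
  exact hmem.trans (TuckerDisplacement.tuckerStorage_mono ht)
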